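/- Let $X$ and $Y$ be Banach spaces over the same field $\mathbb{K}\in\{\mathbb{R},\mathbb{C}\}$, let $\Omega$ be a compact Hausdorff space with Borel $\sigma$-algebra $\Sigma$, and let $\mathcal{C}(\Omega)$ be the Banach space of continuous functions $\Omega\to\mathbb{K}$ with the supremum norm. A vector measure is a finitely additive map $m:\Sigma\to V$ into a Banach space $V$ over $\mathbb{K}$; its semivariation is $\|m\|(E)=\sup\{|v^*\circ m|(E): v^*\in V^*,\ \|v^*\|\le 1\}$, where $|\cdot|$ denotes the variation (the supremum of $\sum_i|v^*(m(A_i))|$ over finite partitions $(A_i)$ of $E$ into sets of $\Sigma$). For a bounded linear operator $T:\mathcal{C}(\Omega)\to Y$, the representing measure of $T$ is the vector measure $\mu:\Sigma\to Y^{**}$ of bounded semivariation (that is, $\|\mu\|(\Omega)<\infty$) such that, for every $y^*\in Y^*$, the scalar set function $E\mapsto\langle y^*,\mu(E)\rangle$ is a regular countably additive Borel measure, and such that $T\varphi=\int_\Omega\varphi\,d\mu$ for all $\varphi\in\mathcal{C}(\Omega)$. Here $Y\subset Y^{**}$ canonically, and the integral is the elementary Bartle integral: the norm limit of the integrals of $\Sigma$-simple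 scalar functions converging uniformly to $\varphi$. Let $S\in\mathcal{L}(\mathcal{C}(\Omega),\mathcal{L}(X,Y))$ and, for $x\in X$, let $S_x\in\mathcal{L}(\mathcal{C}(\Omega),Y)$ be given by $S_x\varphi=(S\varphi)x$. Then there is exactly one vector measure $m:\Sigma\to\mathcal{L}(X,Y^{**})$ such that, for every $x\in X$, the map $E\mapsto m(E)x$ is the representing measure of $S_x$. This $m$, called the representing measure of $S$, satisfies $$\|m\|(\Omega)=\|S\|.$$ -/

import Mathlib

set_option maxSynthPendingDepth 3

open MeasureTheory Filter Topology
open scoped ENNReal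

/-- A (finitely additive) vector measure on the `σ`-algebra of measurable subsets of `Ω`.  As for
`MeasureTheory.VectorMeasure`, the value on non-measurable sets is set to `0`, so that two vector
measures are equal exactly when they agree on the `σ`-algebra. -/
@[ext]
structure FinAddMeasure (Ω : Type*) [MeasurableSpace Ω] (V : Type*) [NormedAddCommGroup V] where
  toFun : Set Ω → V
  not_measurable' : ∀ E : Set Ω, ¬ MeasurableSet E → toFun E = 0
  union' : ∀ E F : Set Ω, MeasurableSet E → MeasurableSet F → Disjoint E F →
    toFun (E ∪ F) = toFun E + toFun F

namespace FinAddMeasure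

instance {Ω V : Type*} [MeasurableSpace Ω] [NormedAddCommGroup V] :
    CoeFun (FinAddMeasure Ω V) (fun _ => Set Ω → V) := ⟨FinAddMeasure.toFun⟩

/-- The image `E ↦ L (m E)` of a vector measure under a bounded linear operator. -/
def map {𝕜 Ω V W : Type*} [RCLike 𝕜] [MeasurableSpace Ω] [NormedAddCommGroup V] [NormedSpace 𝕜 V]
    [NormedAddCommGroup W] [NormedSpace 𝕜 W] (m : FinAddMeasure Ω V) (L : V →L[𝕜] W) :
    FinAddMeasure Ω W where
  toFun E := L (m E)
  not_measurable' E hE := by rw [m.not_measurable' E hE, map_zero]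
  union' E F hE hF h := by rw [m.union' E F hE hF h, map_add]

/-- The variation `|m|(E)`: the supremum of `∑ ‖m(A)‖` over the finite partitions of `E` into
pairwise disjoint measurable sets `A`. -/
noncomputable def variation {Ω V : Type*} [MeasurableSpace Ω] [NormedAddCommGroup V]
    (m : FinAddMeasure Ω V) (E : Set Ω) : ℝ≥0∞ :=
  preVariationFun (fun A => ‖m A‖ₑ) E

/-- The semivariation `‖m‖(E) = sup {|v* ∘ m|(E) : v* ∈ V*, ‖v*‖ ≤ 1}`, where `V*` is the dual over
the scalar field `𝕜` (real or complex). -/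
noncomputable def semivariation (𝕜 : Type*) {Ω V : Type*} [RCLike 𝕜] [MeasurableSpace Ω]
    [NormedAddCommGroup V] [NormedSpace 𝕜 V] (m : FinAddMeasure Ω V) (E : Set Ω) : ℝ≥0∞ :=
  ⨆ v' ∈ {v' : StrongDual 𝕜 V | ‖v'‖ ≤ 1}, (m.map v').variation E

/-- Countable additivity. -/
def IsCountablyAdditive {Ω V : Type*} [MeasurableSpace Ω] [NormedAddCommGroup V]
    (m : FinAddMeasure Ω V) : Prop :=
  ∀ E : ℕ → Set Ω, (∀ i, MeasurableSet (E i)) → Pairwise (fun i j => Disjoint (E i) (E j)) →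
    HasSum (fun i => m (E i)) (m (⋃ i, E i))

/-- Regularity of a Borel measure: every Borel set `E` can be enclosed as `K ⊆ E ⊆ U` with `K`
compact, `U` open and `|m|(U \ K)` arbitrarily small. -/
def IsRegular {Ω V : Type*} [TopologicalSpace Ω] [MeasurableSpace Ω] [NormedAddCommGroup V]
    (m : FinAddMeasure Ω V) : Prop :=
  ∀ E : Set Ω, MeasurableSet E → ∀ ε : ℝ≥0∞, 0 < ε →
    ∃ K U : Set Ω, IsCompact K ∧ IsOpen U ∧ K ⊆ E ∧ E ⊆ U ∧ m.variation (U \ K) < ε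

/-- The integral `∑ c • m({s = c})` of a scalar simple function `s`; the sum runs over the finitely
many values `c` of `s`. -/
noncomputable def simpleIntegral {𝕜 Ω V : Type*} [RCLike 𝕜] [MeasurableSpace Ω]
    [NormedAddCommGroup V] [NormedSpace 𝕜 V] (m : FinAddMeasure Ω V) (s : SimpleFunc Ω 𝕜) : V :=
  ∑ c ∈ s.range, c • m (s ⁻¹' {c})

/-- `m.HasIntegral φ v` says that `v` is the elementary Bartle integral `∫ φ dm` of `φ`, a uniform
limit of scalar simple functions: the integrals of simple functions converging uniformly to `φ`
converge in norm to `v`. -/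
def HasIntegral {𝕜 Ω V : Type*} [RCLike 𝕜] [MeasurableSpace Ω]
    [NormedAddCommGroup V] [NormedSpace 𝕜 V] (m : FinAddMeasure Ω V) (φ : Ω → 𝕜) (v : V) : Prop :=
  (∃ s : ℕ → SimpleFunc Ω 𝕜, TendstoUniformly (fun n => (s n : Ω → 𝕜)) φ atTop) ∧
  ∀ s : ℕ → SimpleFunc Ω 𝕜, TendstoUniformly (fun n => (s n : Ω → 𝕜)) φ atTop →
    Tendsto (fun n => m.simpleIntegral (s n)) atTop (𝓝 v)

end FinAddMeasure

/-- `m : Σ → Y**` is the (classical) representing measure of `T : C(Ω) → Y`: it is a vector measure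
of bounded semivariation, the scalar set function `E ↦ ⟨y*, m(E)⟩` is a regular countably additive
Borel measure for each `y* ∈ Y*`, and `T φ = ∫ φ dm` (with `Y ⊆ Y**` canonically) for all `φ`. -/
structure IsRepresentingMeasure {𝕜 Ω Y : Type*} [RCLike 𝕜]
    [TopologicalSpace Ω] [CompactSpace Ω] [MeasurableSpace Ω]
    [NormedAddCommGroup Y] [NormedSpace 𝕜 Y]
    (T : C(Ω, 𝕜) →L[𝕜] Y) (m : FinAddMeasure Ω (StrongDual 𝕜 (StrongDual 𝕜 Y))) : Prop where
  semivariation_lt_top : m.semivariation 𝕜 Set.univ < ∞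
  countablyAdditive : ∀ y' : StrongDual 𝕜 Y,
    (m.map (ContinuousLinearMap.apply 𝕜 𝕜 y')).IsCountablyAdditive
  regular : ∀ y' : StrongDual 𝕜 Y, (m.map (ContinuousLinearMap.apply 𝕜 𝕜 y')).IsRegular
  integral_eq : ∀ φ : C(Ω, 𝕜), m.HasIntegral φ (NormedSpace.inclusionInDoubleDual 𝕜 Y (T φ))

/-- For `S : C(Ω) → L(X, Y)`, the operator `S_x : C(Ω) → Y`, `S_x φ = (S φ) x`. -/
noncomputable def pointOperator {𝕜 Ω X Y : Type*} [RCLike 𝕜] [TopologicalSpace Ω] [CompactSpace Ω]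
    [NormedAddCommGroup X] [NormedSpace 𝕜 X] [NormedAddCommGroup Y] [NormedSpace 𝕜 Y]
    (S : C(Ω, 𝕜) →L[𝕜] (X →L[𝕜] Y)) (x : X) : C(Ω, 𝕜) →L[𝕜] Y :=
  (ContinuousLinearMap.apply 𝕜 Y x).comp S

/-- `m : Σ → L(X, Y**)` is the representing measure of `S : C(Ω) → L(X, Y)`: for each `x ∈ X`, the
set function `E ↦ m(E) x` is the representing measure `m_x : Σ → Y**` of `S_x`. -/
def IsOperatorRepresentingMeasure {𝕜 Ω X Y : Type*} [RCLike 𝕜]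
    [TopologicalSpace Ω] [CompactSpace Ω] [MeasurableSpace Ω]
    [NormedAddCommGroup X] [NormedSpace 𝕜 X] [NormedAddCommGroup Y] [NormedSpace 𝕜 Y]
    (S : C(Ω, 𝕜) →L[𝕜] (X →L[𝕜] Y))
    (m : FinAddMeasure Ω (X →L[𝕜] StrongDual 𝕜 (StrongDual 𝕜 Y))) : Prop :=
  ∀ x : X, IsRepresentingMeasure (pointOperator S x)
    (m.map (ContinuousLinearMap.apply 𝕜 (StrongDual 𝕜 (StrongDual 𝕜 Y)) x))

/-! Everything reduces to one universal measure `bidualMeasure`, with values in `C(Ω)**`, which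
sends `E` to `l ↦ μ_l(E)`, where `μ_l` is the scalar measure representing `l ∈ C(Ω)*`. The operator
`bidualOperator S` sends `ψ` to `(x, y*) ↦ ψ(y* ∘ S_x)`; it has norm at most `‖S‖`, and it carries
the universal measure to the representing measure of `S`. This gives existence. Since the universal
measure has semivariation at most `1`, it also gives `‖m‖(Ω) ≤ ‖S‖`.

The reverse inequality comes from testing `m` against the functionals `A ↦ ⟨y*, A x⟩`, of norm at
most `‖x‖ ‖y*‖`, and bounding `y*(S φ x)` by `‖φ‖` times the variation of the resulting scalar
measure. The same functionals separate points, so uniqueness is a scalar question: by regularity and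
Urysohn's lemma, integrals of continuous functions determine a regular set function of finite
variation (`eq_of_hasIntegral_eq`).

The scalar Riesz theorem is obtained from the positive case: the total variation of `l` is a
positive functional, hence given by a regular measure `ρ`; then `l` extends continuously to `L¹(ρ)`,
and `μ_l(E)` is the value of the extension at the indicator of `E`. -/

namespace FinAddMeasure

/-! ### Variation of finitely additive set functions and domination by a measure. -/

section Basic

variable {Ω V : Type*} [MeasurableSpace Ω] [NormedAddCommGroup V]

theorem apply_empty (m : FinAddMeasure Ω V) : m ∅ = 0 := by
  have h := m.union' ∅ ∅ .empty .empty (by simp)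
  simpa using h

/-- For the zero measure the finiteness side conditions of `FinMeasAdditive` always hold, so the
`setToSimpleFunc` calculus becomes available. -/
theorem finMeasAdditive (m : FinAddMeasure Ω V) : FinMeasAdditive (0 : Measure Ω) m.toFun :=
  fun s t hs ht _ _ hst => m.union' s t hs ht hst

theorem apply_biUnion {ι : Type*} (m : FinAddMeasure Ω V) (t : Finset ι) {A : ι → Set Ω}
    (hA : ∀ i, MeasurableSet (A i)) (hd : Pairwise fun i j => Disjoint (A i) (A j)) :
    m (⋃ i ∈ t, A i) = ∑ i ∈ t, m (A i) :=
  m.finMeasAdditive.map_iUnion_fin_meas_set_eq_sum _ m.apply_empty A t hA (by simp)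
    fun _ _ _ _ hij => hd hij

/-- A disjoint family can repeat only the empty set, where `m` vanishes, so passing to a finset of
sets and discarding the empty one leaves the sum unchanged. -/
theorem sum_le_variation {ι : Type*} (m : FinAddMeasure Ω V) (t : Finset ι) {A : ι → Set Ω}
    {E : Set Ω} (hE : MeasurableSet E) (hA : ∀ i, MeasurableSet (A i)) (hAE : ∀ i ∈ t, A i ⊆ E)
    (hd : Pairwise fun i j => Disjoint (A i) (A j)) :
    ∑ i ∈ t, ‖m (A i)‖ₑ ≤ m.variation E := by
  classical
  let A' : ι → Subtype (MeasurableSet (α := Ω)) := fun i => ⟨A i, hA i⟩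
  have hd' : (t : Set ι).PairwiseDisjoint A' := fun i _ j _ hij =>
    (disjoint_subtype_iff (fun _ _ hs ht ↦ hs.inter ht) _).2 (hd hij)
  have hd'' : ((t.image A' : Finset _) : Set (Subtype (MeasurableSet (α := Ω)))).PairwiseDisjoint
      id := by
    rw [Finset.coe_image]
    rintro _ ⟨i, hi, rfl⟩ _ ⟨j, hj, rfl⟩ hij
    exact hd' hi hj fun h => hij (by rw [h])
  let P := Finpartition.ofPairwiseDisjoint (t.image A') hd''
  have hle : (t.image A').sup id ≤ ⟨E, hE⟩ := by
    refine Finset.sup_le fun a ha => ?_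
    obtain ⟨i, hi, rfl⟩ := Finset.mem_image.1 ha
    exact hAE i hi
  calc ∑ i ∈ t, ‖m (A i)‖ₑ = ∑ a ∈ t.image A', ‖m (a : Set Ω)‖ₑ :=
        (Finset.sum_image_of_disjoint
          (g := fun a : Subtype (MeasurableSet (α := Ω)) => ‖m (a : Set Ω)‖ₑ)
          (by simp [m.apply_empty]) hd').symm
    _ = ∑ a ∈ P.parts, ‖m (a : Set Ω)‖ₑ :=
        (Finpartition.sum_ofPairwiseDisjoint_eq_sum
          (f := fun a : Subtype (MeasurableSet (α := Ω)) => ‖m (a : Set Ω)‖ₑ) hd''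
          (by simp [m.apply_empty])).symm
    _ ≤ m.variation E :=
        preVariation.sum_le_preVariationFun_of_subset (fun A => ‖m A‖ₑ) _ hE hle P

theorem variation_le (m : FinAddMeasure Ω V) {E : Set Ω} {C : ℝ≥0∞}
    (h : ∀ (t : Finset (Subtype (MeasurableSet (α := Ω)))),
      (t : Set (Subtype (MeasurableSet (α := Ω)))).PairwiseDisjoint (fun a => (a : Set Ω)) →
      (∀ a ∈ t, (a : Set Ω) ⊆ E) → ∑ a ∈ t, ‖m a‖ₑ ≤ C) : m.variation E ≤ C := by
  by_cases hE : MeasurableSet E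
  · rw [variation, preVariationFun_apply _ hE]
    refine iSup_le fun P => h _ ?_ fun a ha => P.le ha
    intro i hi j hj hij
    exact (disjoint_subtype_iff (fun _ _ hs ht ↦ hs.inter ht) _).1 (P.disjoint hi hj hij)
  · rw [variation, preVariationFun_of_not_measurableSet _ hE]
    exact zero_le

theorem variation_mono (m : FinAddMeasure Ω V) {E F : Set Ω} (hF : MeasurableSet F) (h : E ⊆ F) :
    m.variation E ≤ m.variation F :=
  preVariation.mono _ hF h

theorem variation_le_measure (m : FinAddMeasure Ω V) {ρ : Measure Ω}
    (h : ∀ E, MeasurableSet E → ‖m E‖ₑ ≤ ρ E) (E : Set Ω) : m.variation E ≤ ρ E := by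
  refine m.variation_le fun t ht htE => ?_
  calc ∑ a ∈ t, ‖m a‖ₑ ≤ ∑ a ∈ t, ρ a := Finset.sum_le_sum fun a _ => h a a.2
    _ = ρ (⋃ a ∈ t, (a : Set Ω)) := (measure_biUnion_finset ht fun a _ => a.2).symm
    _ ≤ ρ E := measure_mono (Set.iUnion₂_subset htE)

/-- The error after finitely many terms is `m` of the remaining union, bounded by its `ρ`-measure,
which tends to zero. -/
theorem isCountablyAdditive_of_le_measure (m : FinAddMeasure Ω V) {ρ : Measure Ω}
    [IsFiniteMeasure ρ] (h : ∀ E, MeasurableSet E → ‖m E‖ₑ ≤ ρ E) : m.IsCountablyAdditive := by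
  intro E hE hd
  have hρ : HasSum (fun i => ρ.real (E i)) (ρ.real (⋃ i, E i)) := by
    simp only [Measure.real]
    rw [measure_iUnion hd hE, ENNReal.tsum_toReal_eq fun _ => measure_ne_top _ _]
    exact ENNReal.hasSum_toReal (by rw [← measure_iUnion hd hE]; exact measure_ne_top ρ _)
  refine tendsto_iff_norm_sub_tendsto_zero.2 ?_
  have h0 : Tendsto (fun t : Finset ℕ => ρ.real (⋃ i, E i) - ∑ i ∈ t, ρ.real (E i)) atTop (𝓝 0) := by
    simpa using hρ.const_sub (ρ.real (⋃ i, E i))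
  refine squeeze_zero (fun _ => norm_nonneg _) (fun t => ?_) h0
  have hmt : MeasurableSet (⋃ i ∈ t, E i) := t.measurableSet_biUnion fun i _ => hE i
  have hsub : (⋃ i ∈ t, E i) ⊆ ⋃ i, E i := Set.iUnion₂_subset fun i _ => Set.subset_iUnion E i
  have hmd := (MeasurableSet.iUnion hE).diff hmt
  have h1 := m.union' _ _ hmt hmd Set.disjoint_sdiff_right
  rw [Set.union_sdiff_cancel hsub, m.apply_biUnion t hE hd] at h1
  have h2 : ρ.real ((⋃ i, E i) \ ⋃ i ∈ t, E i) = ρ.real (⋃ i, E i) - ∑ i ∈ t, ρ.real (E i) := by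
    rw [measureReal_sdiff hsub hmt, measureReal_biUnion_finset (fun i _ j _ hij => hd hij)
      fun i _ => hE i]
  rw [← h2, h1, norm_sub_rev, add_sub_cancel_left, Measure.real, ← toReal_enorm]
  exact ENNReal.toReal_mono (measure_ne_top _ _) (h _ hmd)

theorem isRegular_of_le_measure [TopologicalSpace Ω] [T2Space Ω] [OpensMeasurableSpace Ω]
    (m : FinAddMeasure Ω V) {ρ : Measure Ω} [IsFiniteMeasure ρ] [ρ.Regular]
    (h : ∀ E, MeasurableSet E → ‖m E‖ₑ ≤ ρ E) : m.IsRegular := by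
  intro E hE ε hε
  have hε2 : ε / 2 ≠ 0 := (ENNReal.half_pos hε.ne').ne'
  obtain ⟨U, hEU, hU, -, hUE⟩ := hE.exists_isOpen_sdiff_lt (measure_ne_top ρ E) hε2
  obtain ⟨K, hKE, hK, hEK⟩ := hE.exists_isCompact_sdiff_lt (measure_ne_top ρ E) hε2
  refine ⟨K, U, hK, hU, hKE, hEU, ?_⟩
  calc m.variation (U \ K) ≤ ρ (U \ K) := m.variation_le_measure h _
    _ ≤ ρ ((U \ E) ∪ (E \ K)) := measure_mono fun x hx => by
        by_cases hxE : x ∈ E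
        · exact Or.inr ⟨hxE, hx.2⟩
        · exact Or.inl ⟨hx.1, hxE⟩
    _ ≤ ρ (U \ E) + ρ (E \ K) := measure_union_le _ _
    _ < ε / 2 + ε / 2 := ENNReal.add_lt_add hUE hEK
    _ = ε := ENNReal.add_halves ε

end Basic

/-! ### The elementary Bartle integral and its estimates by variation. -/

section Integral

variable {𝕜 Ω V W : Type*} [RCLike 𝕜] [MeasurableSpace Ω] [NormedAddCommGroup V] [NormedSpace 𝕜 V]
  [NormedAddCommGroup W] [NormedSpace 𝕜 W]

theorem map_apply (m : FinAddMeasure Ω V) (L : V →L[𝕜] W) (E : Set Ω) : m.map L E = L (m E) := rfl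

theorem simpleIntegral_map (m : FinAddMeasure Ω V) (L : V →L[𝕜] W) (s : SimpleFunc Ω 𝕜) :
    (m.map L).simpleIntegral s = L (m.simpleIntegral s) := by
  simp [simpleIntegral, map_apply]

theorem HasIntegral.map {m : FinAddMeasure Ω V} {φ : Ω → 𝕜} {v : V} (h : m.HasIntegral φ v)
    (L : V →L[𝕜] W) : (m.map L).HasIntegral φ (L v) := by
  refine ⟨h.1, fun s hs => ?_⟩
  simp only [simpleIntegral_map]
  exact (L.continuous.tendsto v).comp (h.2 s hs)

/-- The real-linear operator-valued set function `E ↦ (c ↦ c • m E)`, whose elementary integral is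
`simpleIntegral`. -/
noncomputable def smulOperator [NormedSpace ℝ V] [IsScalarTower ℝ 𝕜 V] (m : FinAddMeasure Ω V)
    (E : Set Ω) : 𝕜 →L[ℝ] V :=
  (ContinuousLinearMap.toSpanSingleton 𝕜 (m E)).restrictScalars ℝ

theorem smulOperator_additive [NormedSpace ℝ V] [IsScalarTower ℝ 𝕜 V] (m : FinAddMeasure Ω V) :
    FinMeasAdditive (0 : Measure Ω) (m.smulOperator (𝕜 := 𝕜)) := by
  intro s t hs ht _ _ hst
  ext
  simp [smulOperator, m.union' s t hs ht hst]

theorem simpleIntegral_eq_setToSimpleFunc [NormedSpace ℝ V] [IsScalarTower ℝ 𝕜 V]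
    (m : FinAddMeasure Ω V) (s : SimpleFunc Ω 𝕜) :
    m.simpleIntegral s = s.setToSimpleFunc m.smulOperator := by
  simp [simpleIntegral, SimpleFunc.setToSimpleFunc, smulOperator]

theorem simpleIntegral_add (m : FinAddMeasure Ω V) (s t : SimpleFunc Ω 𝕜) :
    m.simpleIntegral (s + t) = m.simpleIntegral s + m.simpleIntegral t := by
  -- `setToSimpleFunc` takes real-linear operators, so the scalars are restricted locally.
  let _ : NormedSpace ℝ V := NormedSpace.restrictScalars ℝ 𝕜 V
  have : IsScalarTower ℝ 𝕜 V := IsScalarTower.of_algebraMap_smul fun _ _ => rfl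
  simp only [simpleIntegral_eq_setToSimpleFunc]
  exact SimpleFunc.setToSimpleFunc_add _ m.smulOperator_additive (by simp) (by simp)

theorem simpleIntegral_sub (m : FinAddMeasure Ω V) (s t : SimpleFunc Ω 𝕜) :
    m.simpleIntegral (s - t) = m.simpleIntegral s - m.simpleIntegral t := by
  rw [eq_sub_iff_add_eq, ← simpleIntegral_add, sub_add_cancel]

theorem simpleIntegral_piecewise_const (m : FinAddMeasure Ω V) {E : Set Ω} (hE : MeasurableSet E)
    (c : 𝕜) :
    m.simpleIntegral (SimpleFunc.piecewise E hE (SimpleFunc.const Ω c) (SimpleFunc.const Ω 0)) =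
      c • m E := by
  let _ : NormedSpace ℝ V := NormedSpace.restrictScalars ℝ 𝕜 V
  have : IsScalarTower ℝ 𝕜 V := IsScalarTower.of_algebraMap_smul fun _ _ => rfl
  rw [simpleIntegral_eq_setToSimpleFunc, SimpleFunc.setToSimpleFunc_indicator]
  · simp [smulOperator]
  · ext; simp [smulOperator, m.apply_empty]

/-- The fibre over `0` may leave `E` but contributes nothing; the other fibres are disjoint subsets
of `E`. -/
theorem enorm_simpleIntegral_le (m : FinAddMeasure Ω V) (s : SimpleFunc Ω 𝕜) {E : Set Ω}
    (hE : MeasurableSet E) {C : ℝ≥0∞} (hC : ∀ ω ∈ E, ‖s ω‖ₑ ≤ C) (h0 : ∀ ω ∉ E, s ω = 0) :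
    ‖m.simpleIntegral s‖ₑ ≤ C * m.variation E := by
  classical
  have h1 : m.simpleIntegral s = ∑ c ∈ s.range.filter (· ≠ 0), c • m (s ⁻¹' {c}) := by
    rw [simpleIntegral, Finset.sum_filter_of_ne]
    rintro c - hc rfl
    simp at hc
  have hsub : ∀ c ∈ s.range.filter (· ≠ 0), s ⁻¹' {c} ⊆ E := by
    intro c hc ω hω
    by_contra h
    refine (Finset.mem_filter.1 hc).2 ?_
    rw [← show s ω = c from hω, h0 ω h]
  rw [h1]
  calc ‖∑ c ∈ s.range.filter (· ≠ 0), c • m (s ⁻¹' {c})‖ₑ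
      ≤ ∑ c ∈ s.range.filter (· ≠ 0), ‖c • m (s ⁻¹' {c})‖ₑ := enorm_sum_le _ _
    _ ≤ ∑ c ∈ s.range.filter (· ≠ 0), C * ‖m (s ⁻¹' {c})‖ₑ := by
        refine Finset.sum_le_sum fun c hc => ?_
        rw [enorm_smul]
        gcongr
        obtain ⟨ω, rfl⟩ := SimpleFunc.mem_range.1 (Finset.mem_filter.1 hc).1
        exact hC ω (hsub _ hc rfl)
    _ = C * ∑ c ∈ s.range.filter (· ≠ 0), ‖m (s ⁻¹' {c})‖ₑ := by rw [Finset.mul_sum]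
    _ ≤ C * m.variation E := by
        gcongr
        refine m.sum_le_variation _ hE (fun c => s.measurableSet_fiber c) hsub fun c d hcd => ?_
        exact Disjoint.preimage _ (by simpa using hcd)

/-- Approximants within `ε` of `φ` are bounded by `C + ε`. Finite variation allows `ε → 0`. -/
theorem HasIntegral.enorm_le {m : FinAddMeasure Ω V} {φ : Ω → 𝕜} {v : V} (h : m.HasIntegral φ v)
    (htop : m.variation Set.univ ≠ ∞) {C : ℝ} (hC : ∀ ω, ‖φ ω‖ ≤ C) :
    ‖v‖ₑ ≤ ENNReal.ofReal C * m.variation Set.univ := by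
  obtain ⟨s, hs⟩ := h.1
  have key : ∀ ε : ℝ, 0 < ε → ‖v‖ₑ ≤ ENNReal.ofReal (C + ε) * m.variation Set.univ := by
    intro ε hε
    have hcl : Tendsto (fun n => ‖m.simpleIntegral (s n)‖ₑ) atTop (𝓝 ‖v‖ₑ) :=
      (h.2 s hs).enorm
    refine le_of_tendsto hcl ?_
    filter_upwards [Metric.tendstoUniformly_iff.1 hs ε hε] with n hn
    refine m.enorm_simpleIntegral_le (s n) .univ (fun ω _ => ?_) (by simp)
    rw [← ofReal_norm]
    refine ENNReal.ofReal_le_ofReal ?_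
    have h1 := hn ω
    rw [dist_eq_norm, norm_sub_rev] at h1
    have h2 := norm_add_le (φ ω) (s n ω - φ ω)
    rw [add_sub_cancel] at h2
    linarith [hC ω]
  have hlim : Tendsto (fun ε : ℝ => ENNReal.ofReal (C + ε) * m.variation Set.univ) (𝓝[>] 0)
      (𝓝 (ENNReal.ofReal C * m.variation Set.univ)) := by
    refine ENNReal.Tendsto.mul_const ?_ (Or.inr htop)
    refine ENNReal.tendsto_ofReal ?_
    have : Tendsto (fun ε : ℝ => C + ε) (𝓝 0) (𝓝 (C + 0)) := tendsto_const_nhds.add tendsto_id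
    rw [add_zero] at this
    exact this.mono_left nhdsWithin_le_nhds
  refine ge_of_tendsto hlim ?_
  filter_upwards [self_mem_nhdsWithin] with ε hε using key ε hε

theorem variation_map_smul_le (m : FinAddMeasure Ω V) (c : 𝕜) (v' : StrongDual 𝕜 V) (E : Set Ω) :
    (m.map (c • v')).variation E ≤ ‖c‖ₑ * (m.map v').variation E := by
  by_cases hE : MeasurableSet E
  · rw [variation, variation, preVariationFun_apply _ hE, preVariationFun_apply _ hE]
    refine iSup_le fun P => ?_
    refine le_trans ?_ (mul_le_mul_right (le_iSup _ P) _)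
    rw [Finset.mul_sum]
    refine Finset.sum_le_sum fun a _ => ?_
    simp [map_apply, enorm_mul]
  · rw [variation, preVariationFun_of_not_measurableSet _ hE]
    exact zero_le

/-- Homogeneity reduces a nonzero functional to its normalisation in the unit ball. -/
theorem variation_map_le (m : FinAddMeasure Ω V) (v' : StrongDual 𝕜 V) (E : Set Ω) :
    (m.map v').variation E ≤ ‖v'‖ₑ * m.semivariation 𝕜 E := by
  rcases eq_or_ne v' 0 with rfl | hv
  · have := m.variation_map_smul_le (0 : 𝕜) 0 E
    simpa using this
  have hn : (‖v'‖ : 𝕜) ≠ 0 := by simpa using hv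
  have h1 : v' = (‖v'‖ : 𝕜) • ((‖v'‖ : 𝕜)⁻¹ • v') := by rw [smul_inv_smul₀ hn]
  have h2 : ‖(‖v'‖ : 𝕜)⁻¹ • v'‖ ≤ 1 := by
    rw [norm_smul, norm_inv, RCLike.norm_ofReal, abs_norm, inv_mul_cancel₀ (by simpa using hv)]
  calc (m.map v').variation E
      = (m.map ((‖v'‖ : 𝕜) • ((‖v'‖ : 𝕜)⁻¹ • v'))).variation E := by rw [← h1]
    _ ≤ ‖(‖v'‖ : 𝕜)‖ₑ * (m.map ((‖v'‖ : 𝕜)⁻¹ • v')).variation E := m.variation_map_smul_le _ _ _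
    _ ≤ ‖v'‖ₑ * m.semivariation 𝕜 E := by
        have h3 : ‖(‖v'‖ : 𝕜)‖ₑ = ‖v'‖ₑ := by
          rw [← ofReal_norm, RCLike.norm_ofReal, abs_norm, ofReal_norm]
        rw [h3]
        gcongr
        exact le_iSup₂ (f := fun (w : StrongDual 𝕜 V) (_ : w ∈ {w : StrongDual 𝕜 V | ‖w‖ ≤ 1}) =>
          (m.map w).variation E) _ h2

theorem semivariation_map_le (m : FinAddMeasure Ω V) (L : V →L[𝕜] W) (E : Set Ω) :
    (m.map L).semivariation 𝕜 E ≤ ‖L‖ₑ * m.semivariation 𝕜 E := by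
  refine iSup₂_le fun w hw => ?_
  calc ((m.map L).map w).variation E = (m.map (w.comp L)).variation E := rfl
    _ ≤ ‖w.comp L‖ₑ * m.semivariation 𝕜 E := m.variation_map_le _ _
    _ ≤ ‖L‖ₑ * m.semivariation 𝕜 E := by
        gcongr
        rw [← ofReal_norm, ← ofReal_norm]
        refine ENNReal.ofReal_le_ofReal ((w.opNorm_comp_le L).trans ?_)
        exact mul_le_of_le_one_left (norm_nonneg _) hw

/-- The difference of `φ` and the indicator of `E` vanishes off `U \ K` and is at most `1` on it.
The two bounds in `hφ` cover the two values of the indicator. -/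
theorem enorm_integral_sub_apply_le [TopologicalSpace Ω] [OpensMeasurableSpace Ω]
    {m : FinAddMeasure Ω V} {φ : Ω → 𝕜} {v : V} (h : m.HasIntegral φ v)
    (hfin : m.variation Set.univ ≠ ∞) {K E U : Set Ω} (hE : MeasurableSet E)
    (hD : MeasurableSet (U \ K)) (hKE : K ⊆ E) (hEU : E ⊆ U)
    (hK : ∀ ω ∈ K, φ ω = 1) (hU : ∀ ω ∉ U, φ ω = 0) (hφ : ∀ ω, ‖φ ω - 1‖ ≤ 1 ∧ ‖φ ω‖ ≤ 1) :
    ‖v - m E‖ₑ ≤ m.variation (U \ K) := by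
  obtain ⟨s, hs⟩ := h.1
  set e : SimpleFunc Ω 𝕜 := SimpleFunc.piecewise E hE (SimpleFunc.const Ω 1) (SimpleFunc.const Ω 0)
    with he
  have hme : m.simpleIntegral e = m E := by
    rw [he, simpleIntegral_piecewise_const, one_smul]
  have hDfin : m.variation (U \ K) ≠ ∞ :=
    ((m.variation_mono .univ (Set.subset_univ _)).trans_lt hfin.lt_top).ne
  have key : ∀ ε : ℝ, 0 < ε → ‖v - m E‖ₑ ≤
      ENNReal.ofReal (1 + ε) * m.variation (U \ K) +
        ENNReal.ofReal (0 + ε) * m.variation Set.univ := by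
    intro ε hε
    have hcl : Tendsto (fun n => ‖m.simpleIntegral (s n) - m E‖ₑ) atTop (𝓝 ‖v - m E‖ₑ) :=
      ((h.2 s hs).sub_const _).enorm
    refine le_of_tendsto hcl ?_
    filter_upwards [Metric.tendstoUniformly_iff.1 hs ε hε] with n hn
    have hn' : ∀ ω, ‖s n ω - φ ω‖ ≤ ε := fun ω => by
      have := hn ω
      rw [dist_eq_norm, norm_sub_rev] at this
      exact this.le
    -- Split at `U \ K`: the part inside is bounded by `1 + ε`, the part outside by `ε`, whose
    -- contribution disappears in the limit.
    let d := s n - e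
    let d₁ := SimpleFunc.piecewise (U \ K) hD d 0
    let d₂ := SimpleFunc.piecewise (U \ K)ᶜ hD.compl d 0
    have hd : d = d₁ + d₂ := by
      ext ω
      by_cases hω : ω ∈ U \ K
      · have : ω ∉ (U \ K)ᶜ := by simpa using hω
        simp [d₁, d₂, hω]
      · have : ω ∈ (U \ K)ᶜ := hω
        simp only [d₁, d₂, SimpleFunc.add_apply, SimpleFunc.piecewise_apply, if_pos this,
          if_neg hω, SimpleFunc.coe_zero, Pi.zero_apply, zero_add]
    rw [← hme, ← simpleIntegral_sub]
    change ‖m.simpleIntegral d‖ₑ ≤ _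
    rw [hd, simpleIntegral_add]
    refine (enorm_add_le _ _).trans (add_le_add ?_ ?_)
    · refine m.enorm_simpleIntegral_le _ hD (fun ω hω => ?_) fun ω hω => ?_
      · rw [← ofReal_norm]
        refine ENNReal.ofReal_le_ofReal ?_
        simp only [d₁, SimpleFunc.piecewise_apply, if_pos hω, d, SimpleFunc.sub_apply, he]
        have h3 : ∀ z : 𝕜, ‖φ ω - z‖ ≤ 1 → ‖s n ω - z‖ ≤ 1 + ε := fun z hz => by
          have := norm_add_le (s n ω - φ ω) (φ ω - z)
          rw [sub_add_sub_cancel] at this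
          linarith [hn' ω]
        by_cases hωE : ω ∈ E
        · simpa [hωE] using h3 1 (hφ ω).1
        · simpa [hωE] using h3 0 (by simpa using (hφ ω).2)
      · simp only [d₁, SimpleFunc.piecewise_apply, if_neg hω, SimpleFunc.coe_zero, Pi.zero_apply]
    · refine m.enorm_simpleIntegral_le _ .univ (fun ω _ => ?_) (by simp)
      rw [← ofReal_norm]
      refine ENNReal.ofReal_le_ofReal ?_
      by_cases hω : ω ∈ (U \ K)ᶜ
      · simp only [d₂, SimpleFunc.piecewise_apply, if_pos hω, d, SimpleFunc.sub_apply, he]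
        by_cases hωK : ω ∈ K
        · simpa [hKE hωK, hK ω hωK] using hn' ω
        · have hωU : ω ∉ U := fun h => hω ⟨h, hωK⟩
          have hωE : ω ∉ E := fun h => hωU (hEU h)
          simpa [hωE, hU ω hωU] using hn' ω
      · simp only [d₂, SimpleFunc.piecewise_apply, if_neg hω, SimpleFunc.coe_zero, Pi.zero_apply,
          norm_zero]
        linarith
  have hε : ∀ a : ℝ, Tendsto (fun ε : ℝ => ENNReal.ofReal (a + ε)) (𝓝[>] 0)
      (𝓝 (ENNReal.ofReal a)) := fun a => by
    refine ENNReal.tendsto_ofReal ?_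
    have : Tendsto (fun ε : ℝ => a + ε) (𝓝 0) (𝓝 (a + 0)) := tendsto_const_nhds.add tendsto_id
    rw [add_zero] at this
    exact this.mono_left nhdsWithin_le_nhds
  have hlim := (ENNReal.Tendsto.mul_const (hε 1) (Or.inr hDfin)).add
    (ENNReal.Tendsto.mul_const (hε 0) (Or.inr hfin))
  simp only [ENNReal.ofReal_one, one_mul, ENNReal.ofReal_zero, zero_mul, add_zero] at hlim
  refine ge_of_tendsto hlim ?_
  filter_upwards [self_mem_nhdsWithin] with ε hε using key ε hε

end Integral

/-- A regular set function of finite variation is determined by the integrals of continuous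
functions. -/
theorem eq_of_hasIntegral_eq {𝕜 Ω V : Type*} [RCLike 𝕜] [TopologicalSpace Ω] [CompactSpace Ω]
    [T2Space Ω] [MeasurableSpace Ω] [BorelSpace Ω] [NormedAddCommGroup V] [NormedSpace 𝕜 V]
    {m₁ m₂ : FinAddMeasure Ω V} (h₁ : m₁.IsRegular) (h₂ : m₂.IsRegular)
    (hf₁ : m₁.variation Set.univ ≠ ∞) (hf₂ : m₂.variation Set.univ ≠ ∞) {I : C(Ω, 𝕜) → V}
    (hI₁ : ∀ φ : C(Ω, 𝕜), m₁.HasIntegral φ (I φ)) (hI₂ : ∀ φ : C(Ω, 𝕜), m₂.HasIntegral φ (I φ)) :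
    m₁ = m₂ := by
  ext E
  by_cases hE : MeasurableSet E
  swap
  · rw [m₁.not_measurable' E hE, m₂.not_measurable' E hE]
  rw [← sub_eq_zero, ← enorm_eq_zero]
  refine le_antisymm (ENNReal.le_of_forall_pos_le_add fun δ hδ _ => ?_) zero_le
  have hε : 0 < (δ : ℝ≥0∞) / 2 := ENNReal.half_pos (by simpa using hδ.ne')
  obtain ⟨K₁, U₁, hK₁, hU₁, hKE₁, hEU₁, hlt₁⟩ := h₁ E hE _ hε
  obtain ⟨K₂, U₂, hK₂, hU₂, hKE₂, hEU₂, hlt₂⟩ := h₂ E hE _ hε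
  -- Urysohn separates `K₁ ∪ K₂` from the complement of `U₁ ∩ U₂`, so a single test function
  -- approximates `E` for both set functions.
  obtain ⟨f, hf0, hf1, hf⟩ := exists_continuous_zero_one_of_isClosed
    (hU₁.inter hU₂).isClosed_compl (hK₁.union hK₂).isClosed
    (Set.disjoint_compl_left_iff_subset.2
      (Set.union_subset (Set.subset_inter (hKE₁.trans hEU₁) (hKE₁.trans hEU₂))
        (Set.subset_inter (hKE₂.trans hEU₁) (hKE₂.trans hEU₂))))
  let φ : C(Ω, 𝕜) := ⟨fun ω => (f ω : 𝕜), by fun_prop⟩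
  have hφ : ∀ ω, ‖φ ω - 1‖ ≤ 1 ∧ ‖φ ω‖ ≤ 1 := fun ω => by
    have h := hf ω
    constructor
    · have : φ ω - 1 = ((f ω - 1 : ℝ) : 𝕜) := by simp [φ]
      rw [this, RCLike.norm_ofReal, abs_le]
      constructor <;> linarith [h.1, h.2]
    · change ‖(f ω : 𝕜)‖ ≤ 1
      rw [RCLike.norm_ofReal, abs_le]
      constructor <;> linarith [h.1, h.2]
  have hK : ∀ ω ∈ K₁ ∪ K₂, φ ω = 1 := fun ω hω => by
    change (f ω : 𝕜) = 1
    rw [hf1 hω]; simp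
  have hU : ∀ ω ∉ U₁ ∩ U₂, φ ω = 0 := fun ω hω => by
    change (f ω : 𝕜) = 0
    rw [hf0 hω]; simp
  have e₁ := enorm_integral_sub_apply_le (hI₁ φ) hf₁ hE
    (hU₁.measurableSet.diff hK₁.isClosed.measurableSet) hKE₁ hEU₁ (fun ω h => hK ω (Or.inl h))
    (fun ω h => hU ω fun h' => h h'.1) hφ
  have e₂ := enorm_integral_sub_apply_le (hI₂ φ) hf₂ hE
    (hU₂.measurableSet.diff hK₂.isClosed.measurableSet) hKE₂ hEU₂ (fun ω h => hK ω (Or.inr h))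
    (fun ω h => hU ω fun h' => h h'.2) hφ
  calc ‖m₁ E - m₂ E‖ₑ = ‖(I φ - m₂ E) - (I φ - m₁ E)‖ₑ := by rw [sub_sub_sub_cancel_left]
    _ ≤ ‖I φ - m₂ E‖ₑ + ‖I φ - m₁ E‖ₑ := enorm_sub_le
    _ ≤ δ / 2 + δ / 2 := add_le_add (e₂.trans hlt₂.le) (e₁.trans hlt₁.le)
    _ = 0 + δ := by rw [ENNReal.add_halves, zero_add]

end FinAddMeasure

/-! ### The Riesz representation of functionals on `C(Ω)` through their total variation. -/

section Riesz

open scoped NNReal CompactlySupported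

variable {𝕜 Ω : Type*} [RCLike 𝕜] [TopologicalSpace Ω]

/-- The total variation `|l|(f) = sup {‖l g‖ : ‖g‖ ≤ f}` of a functional `l ∈ C(Ω)*`, on
nonnegative functions `f`. -/
noncomputable def totalVariation (l : StrongDual 𝕜 C(Ω, 𝕜)) (f : C_c(Ω, ℝ≥0)) : ℝ≥0 :=
  ⨆ g : {g : C(Ω, 𝕜) // ∀ ω, ‖g ω‖₊ ≤ f ω}, ‖l g.1‖₊

theorem totalVariation_le (l : StrongDual 𝕜 C(Ω, 𝕜)) {f : C_c(Ω, ℝ≥0)} {C : ℝ≥0}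
    (h : ∀ g : C(Ω, 𝕜), (∀ ω, ‖g ω‖₊ ≤ f ω) → ‖l g‖₊ ≤ C) : totalVariation l f ≤ C := by
  have : Nonempty {g : C(Ω, 𝕜) // ∀ ω, ‖g ω‖₊ ≤ f ω} := ⟨⟨0, by simp⟩⟩
  exact ciSup_le fun g => h g.1 g.2

variable [CompactSpace Ω]

theorem nnnorm_le_totalVariation (l : StrongDual 𝕜 C(Ω, 𝕜)) {f : C_c(Ω, ℝ≥0)} {g : C(Ω, 𝕜)}
    (hg : ∀ ω, ‖g ω‖₊ ≤ f ω) : ‖l g‖₊ ≤ totalVariation l f := by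
  refine le_ciSup (f := fun g : {g : C(Ω, 𝕜) // ∀ ω, ‖g ω‖₊ ≤ f ω} => ‖l g.1‖₊) ?_ ⟨g, hg⟩
  obtain ⟨M, hM⟩ := (isCompact_range (map_continuous f)).bddAbove
  refine ⟨‖l‖₊ * M, ?_⟩
  rintro _ ⟨h, rfl⟩
  refine (l.le_opNNNorm h.1).trans ?_
  gcongr
  exact (ContinuousMap.norm_le _ M.coe_nonneg).2 fun ω => (h.2 ω).trans (hM ⟨ω, rfl⟩)

/-- Riesz decomposition: `g` is split in the proportions `f₁ : f₂`. Since `f₁ + f₂` may vanish, `ε`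
is added to the denominator, at the price of a third piece of norm at most `ε`. -/
theorem totalVariation_add_le (l : StrongDual 𝕜 C(Ω, 𝕜)) (f₁ f₂ : C_c(Ω, ℝ≥0)) :
    totalVariation l (f₁ + f₂) ≤ totalVariation l f₁ + totalVariation l f₂ := by
  refine totalVariation_le l fun g hg => ?_
  rw [← NNReal.coe_le_coe]
  refine le_of_forall_pos_le_add fun δ hδ => ?_
  -- Makes `‖l‖ * ε ≤ δ`, also when `l = 0`.
  set ε : ℝ := δ / (‖l‖ + 1) with hε
  have hε0 : 0 < ε := by positivity
  have hden : ∀ ω, (f₁ ω : ℝ) + f₂ ω + ε ≠ 0 := fun ω => by positivity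
  have hc₁ : Continuous fun ω => (f₁ ω : ℝ) := NNReal.continuous_coe.comp (map_continuous f₁)
  have hc₂ : Continuous fun ω => (f₂ ω : ℝ) := NNReal.continuous_coe.comp (map_continuous f₂)
  let q (a : C(Ω, ℝ)) : C(Ω, 𝕜) :=
    ⟨fun ω => ((a ω / ((f₁ ω : ℝ) + f₂ ω + ε) : ℝ) : 𝕜) * g ω, by
      refine (RCLike.continuous_ofReal.comp ?_).mul (map_continuous g)
      exact (map_continuous a).div₀ ((hc₁.add hc₂).add continuous_const) hden⟩
  have hq : ∀ (a : C(Ω, ℝ)) ω, 0 ≤ a ω → ‖q a ω‖ ≤ a ω := fun a ω ha => by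
    have h1 : ‖g ω‖ ≤ (f₁ ω : ℝ) + f₂ ω := by exact_mod_cast hg ω
    have h2 : ‖q a ω‖ = a ω / ((f₁ ω : ℝ) + f₂ ω + ε) * ‖g ω‖ := by
      change ‖((a ω / ((f₁ ω : ℝ) + f₂ ω + ε) : ℝ) : 𝕜) * g ω‖ = _
      rw [norm_mul, RCLike.norm_ofReal, abs_of_nonneg (by positivity)]
    rw [h2, div_mul_eq_mul_div, div_le_iff₀ (by positivity)]
    gcongr
    linarith
  let g₁ := q ⟨_, hc₁⟩
  let g₂ := q ⟨_, hc₂⟩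
  let g₃ := q (ContinuousMap.const Ω ε)
  have hsum : g = g₁ + g₂ + g₃ := by
    ext ω
    change g ω = ((f₁ ω / ((f₁ ω : ℝ) + f₂ ω + ε) : ℝ) : 𝕜) * g ω +
      ((f₂ ω / ((f₁ ω : ℝ) + f₂ ω + ε) : ℝ) : 𝕜) * g ω +
      ((ε / ((f₁ ω : ℝ) + f₂ ω + ε) : ℝ) : 𝕜) * g ω
    rw [← add_mul, ← add_mul, ← RCLike.ofReal_add, ← RCLike.ofReal_add, ← add_div, ← add_div,
      div_self (hden ω), RCLike.ofReal_one, one_mul]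
  have h₁ : ‖l g₁‖ ≤ totalVariation l f₁ :=
    nnnorm_le_totalVariation l fun ω => hq _ ω (f₁ ω).coe_nonneg
  have h₂ : ‖l g₂‖ ≤ totalVariation l f₂ :=
    nnnorm_le_totalVariation l fun ω => hq _ ω (f₂ ω).coe_nonneg
  have h₃ : ‖l g₃‖ ≤ δ := by
    have h4 : ‖g₃‖ ≤ ε := (ContinuousMap.norm_le _ hε0.le).2 fun ω => hq _ ω hε0.le
    calc ‖l g₃‖ ≤ ‖l‖ * ε := l.le_of_opNorm_le_of_le le_rfl h4
      _ ≤ (‖l‖ + 1) * ε := by gcongr; linarith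
      _ = δ := by rw [hε]; field_simp
  calc ((‖l g‖₊ : ℝ≥0) : ℝ) = ‖l g₁ + l g₂ + l g₃‖ := by rw [hsum, map_add, map_add]; rfl
    _ ≤ ‖l g₁‖ + ‖l g₂‖ + ‖l g₃‖ := norm_add₃_le
    _ ≤ totalVariation l f₁ + totalVariation l f₂ + δ := by gcongr
    _ = _ := by simp

/-- Unimodular factors rotate `l g₁` and `l g₂` onto the nonnegative axis, so the norms add without
cancellation. -/
theorem nnnorm_add_nnnorm_le_totalVariation (l : StrongDual 𝕜 C(Ω, 𝕜)) {f₁ f₂ : C_c(Ω, ℝ≥0)}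
    {g₁ g₂ : C(Ω, 𝕜)} (h₁ : ∀ ω, ‖g₁ ω‖₊ ≤ f₁ ω) (h₂ : ∀ ω, ‖g₂ ω‖₊ ≤ f₂ ω) :
    ‖l g₁‖₊ + ‖l g₂‖₊ ≤ totalVariation l (f₁ + f₂) := by
  obtain ⟨a₁, ha₁, e₁⟩ := RCLike.exists_norm_eq_mul_self (l g₁)
  obtain ⟨a₂, ha₂, e₂⟩ := RCLike.exists_norm_eq_mul_self (l g₂)
  have h := nnnorm_le_totalVariation l (f := f₁ + f₂) (g := a₁ • g₁ + a₂ • g₂) fun ω => by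
    refine (nnnorm_add_le _ _).trans (add_le_add ?_ ?_)
    · have : ‖a₁‖₊ = 1 := NNReal.eq ha₁
      simpa [nnnorm_smul, this] using h₁ ω
    · have : ‖a₂‖₊ = 1 := NNReal.eq ha₂
      simpa [nnnorm_smul, this] using h₂ ω
  refine le_trans (le_of_eq ?_) h
  rw [map_add, map_smul, map_smul, smul_eq_mul, smul_eq_mul, ← e₁, ← e₂, ← RCLike.ofReal_add]
  ext
  rw [coe_nnnorm, RCLike.norm_ofReal, abs_of_nonneg (by positivity)]
  simp

theorem le_totalVariation_add (l : StrongDual 𝕜 C(Ω, 𝕜)) (f₁ f₂ : C_c(Ω, ℝ≥0)) :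
    totalVariation l f₁ + totalVariation l f₂ ≤ totalVariation l (f₁ + f₂) := by
  have h0 : ∀ g : C(Ω, 𝕜), (∀ ω, ‖g ω‖₊ ≤ f₁ ω) →
      ‖l g‖₊ + totalVariation l f₂ ≤ totalVariation l (f₁ + f₂) := fun g hg => by
    have h1 : ‖l g‖₊ ≤ totalVariation l (f₁ + f₂) :=
      nnnorm_le_totalVariation l fun ω => (hg ω).trans (by simp)
    rw [← le_tsub_iff_left h1]
    exact totalVariation_le l fun g' hg' =>
      le_tsub_of_add_le_left (nnnorm_add_nnnorm_le_totalVariation l hg hg')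
  have h2 : totalVariation l f₂ ≤ totalVariation l (f₁ + f₂) := by
    simpa using h0 0 (by simp)
  rw [← le_tsub_iff_right h2]
  exact totalVariation_le l fun g hg => le_tsub_of_add_le_right (h0 g hg)

/-- Applied to `c⁻¹` and `c • f`, this also yields the reverse inequality for `c ≠ 0`. -/
theorem mul_totalVariation_le (l : StrongDual 𝕜 C(Ω, 𝕜)) (c : ℝ≥0) (f : C_c(Ω, ℝ≥0)) :
    c * totalVariation l f ≤ totalVariation l (c • f) := by
  rcases eq_or_ne c 0 with rfl | hc
  · simp
  rw [← le_inv_mul_iff₀ (pos_iff_ne_zero.2 hc)]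
  refine totalVariation_le l fun g hg => ?_
  rw [le_inv_mul_iff₀ (pos_iff_ne_zero.2 hc)]
  have hcn : ‖((c : ℝ) : 𝕜)‖₊ = c := by ext; simp
  have h := nnnorm_le_totalVariation l (f := c • f) (g := ((c : ℝ) : 𝕜) • g) fun ω => by
    simpa [nnnorm_smul, hcn] using mul_le_mul_right (hg ω) c
  rwa [map_smul, nnnorm_smul, hcn] at h

theorem totalVariation_smul (l : StrongDual 𝕜 C(Ω, 𝕜)) (c : ℝ≥0) (f : C_c(Ω, ℝ≥0)) :
    totalVariation l (c • f) = c * totalVariation l f := by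
  refine le_antisymm ?_ (mul_totalVariation_le l c f)
  rcases eq_or_ne c 0 with rfl | hc
  · rw [zero_mul]
    refine totalVariation_le l fun g hg => ?_
    have : g = 0 := by ext ω; simpa using hg ω
    simp [this]
  have h := mul_totalVariation_le l c⁻¹ (c • f)
  rw [inv_smul_smul₀ hc] at h
  rwa [inv_mul_le_iff₀ (pos_iff_ne_zero.2 hc)] at h

/-- The total variation of a functional on `C(Ω)` as a positive linear functional. -/
noncomputable def totalVariationLinearMap (l : StrongDual 𝕜 C(Ω, 𝕜)) :
    C_c(Ω, ℝ≥0) →ₗ[ℝ≥0] ℝ≥0 where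
  toFun := totalVariation l
  map_add' f₁ f₂ := le_antisymm (totalVariation_add_le l f₁ f₂) (le_totalVariation_add l f₁ f₂)
  map_smul' c f := totalVariation_smul l c f

variable [T2Space Ω] [MeasurableSpace Ω] [BorelSpace Ω]

/-- Every functional on `C(Ω)` is dominated by a regular measure of total mass at most its norm. -/
theorem exists_regular_measure_dominating (l : StrongDual 𝕜 C(Ω, 𝕜)) :
    ∃ ρ : Measure Ω, ρ.Regular ∧ ρ Set.univ ≤ ‖l‖ₑ ∧
      ∀ g : C(Ω, 𝕜), ‖l g‖ₑ ≤ ∫⁻ ω, ‖g ω‖ₑ ∂ρ := by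
  refine ⟨NNRealRMK.rieszMeasure (totalVariationLinearMap l), inferInstance, ?_, fun g => ?_⟩
  · let one : C_c(Ω, ℝ≥0) := ⟨ContinuousMap.const Ω 1, HasCompactSupport.of_compactSpace _⟩
    have h := NNRealRMK.lintegral_rieszMeasure (totalVariationLinearMap l) one
    have h1 : ∀ ω, ((one ω : ℝ≥0) : ℝ≥0∞) = 1 := fun ω => rfl
    simp only [h1, lintegral_one] at h
    rw [h, enorm_eq_nnnorm, ENNReal.coe_le_coe]
    refine totalVariation_le l fun g hg => ?_
    refine (l.le_opNNNorm g).trans ?_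
    refine mul_le_of_le_one_right zero_le ?_
    exact (ContinuousMap.norm_le _ zero_le_one).2 fun ω => hg ω
  · let f : C_c(Ω, ℝ≥0) :=
      ⟨⟨fun ω => ‖g ω‖₊, (map_continuous g).nnnorm⟩, HasCompactSupport.of_compactSpace _⟩
    have h := NNRealRMK.lintegral_rieszMeasure (totalVariationLinearMap l) f
    have h1 : ∀ ω, ((f ω : ℝ≥0) : ℝ≥0∞) = ‖g ω‖ₑ := fun ω => rfl
    simp only [h1] at h
    rw [h, enorm_eq_nnnorm, ENNReal.coe_le_coe]
    exact nnnorm_le_totalVariation l fun ω => le_rfl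

/-- The **Riesz representation theorem** for functionals on `C(Ω)`, in the form of a set function
dominated by a regular measure `ρ` whose integral is continuous for the `L¹(ρ)` seminorm. -/
theorem exists_finAddMeasure_representing (l : StrongDual 𝕜 C(Ω, 𝕜)) :
    ∃ (m : FinAddMeasure Ω 𝕜) (ρ : Measure Ω), ρ.Regular ∧ ρ Set.univ ≤ ‖l‖ₑ ∧
      (∀ E, MeasurableSet E → ‖m E‖ₑ ≤ ρ E) ∧
      ∀ (φ : C(Ω, 𝕜)) (s : SimpleFunc Ω 𝕜),
        ‖l φ - m.simpleIntegral s‖ₑ ≤ ∫⁻ ω, ‖φ ω - s ω‖ₑ ∂ρ := by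
  classical
  obtain ⟨ρ, hreg, hρ, hl⟩ := exists_regular_measure_dominating l
  have : IsFiniteMeasure ρ := ⟨hρ.trans_lt enorm_lt_top⟩
  let e : C(Ω, 𝕜) →L[𝕜] Lp 𝕜 1 ρ := ContinuousMap.toLp 1 ρ 𝕜
  have hmem : ∀ φ : C(Ω, 𝕜), MemLp φ 1 ρ := fun φ =>
    .of_bound (map_continuous φ).aestronglyMeasurable ‖φ‖ (.of_forall φ.norm_coe_le_norm)
  have he : ∀ φ, e φ = (hmem φ).toLp φ := fun φ => rfl
  have hdense : DenseRange e := ContinuousMap.toLp_denseRange 𝕜 ρ 𝕜 (by simp)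
  have hnorm : ∀ φ, ‖l φ‖ ≤ 1 * ‖e φ‖ := fun φ => by
    rw [one_mul, ← enorm_le_iff_norm_le, he, Lp.enorm_toLp, eLpNorm_one_eq_lintegral_enorm]
    exact hl φ
  -- Domination by `ρ` makes `l` bounded for the `L¹(ρ)` seminorm, and `C(Ω)` has dense image in
  -- `L¹(ρ)`.
  let L : Lp 𝕜 1 ρ →L[𝕜] 𝕜 := (l : C(Ω, 𝕜) →ₗ[𝕜] 𝕜).extendOfNorm (e : C(Ω, 𝕜) →ₗ[𝕜] Lp 𝕜 1 ρ)
  have hLe : ∀ φ, L (e φ) = l φ := LinearMap.extendOfNorm_eq hdense ⟨1, hnorm⟩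
  have hL : ∀ f (hf : MemLp f 1 ρ), ‖L (hf.toLp f)‖ₑ ≤ ∫⁻ ω, ‖f ω‖ₑ ∂ρ := fun f hf => by
    rw [← eLpNorm_one_eq_lintegral_enorm, ← Lp.enorm_toLp hf, enorm_le_iff_norm_le]
    simpa using LinearMap.norm_extendOfNorm_apply_le hdense 1 hnorm (hf.toLp f)
  have hs : ∀ s : SimpleFunc Ω 𝕜, MemLp s 1 ρ := fun s => s.memLp_of_isFiniteMeasure 1 ρ
  let ind (E : Set Ω) (hE : MeasurableSet E) (c : 𝕜) : SimpleFunc Ω 𝕜 :=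
    SimpleFunc.piecewise E hE (SimpleFunc.const Ω c) (SimpleFunc.const Ω 0)
  let F : SimpleFunc Ω 𝕜 → 𝕜 := fun s => L ((hs s).toLp s)
  have hFadd : ∀ s t, F (s + t) = F s + F t := fun s t => by
    simp only [F, ← map_add]
    congr 1
  have hFsmul : ∀ (c : 𝕜) s, F (c • s) = c * F s := fun c s => by
    simp only [F, ← smul_eq_mul, ← map_smul]
    congr 1
  let m : FinAddMeasure Ω 𝕜 :=
    { toFun := fun E => if hE : MeasurableSet E then F (ind E hE 1) else 0
      not_measurable' := fun E hE => dif_neg hE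
      union' := fun A B hA hB hAB => by
        rw [dif_pos hA, dif_pos hB, dif_pos (hA.union hB), ← hFadd]
        congr 1
        ext ω
        by_cases hωA : ω ∈ A
        · have hωB : ω ∉ B := fun h => Set.disjoint_left.1 hAB hωA h
          simp [ind, hωA, hωB]
        · by_cases hωB : ω ∈ B <;> simp [ind, hωA, hωB] }
  have hm : ∀ E (hE : MeasurableSet E), m E = F (ind E hE 1) := fun E hE => dif_pos hE
  -- Both sides are additive and agree on multiples of indicators.
  have hmF : ∀ s, m.simpleIntegral s = F s := fun s => by
    induction s using SimpleFunc.induction with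
    | const c hE =>
      rw [m.simpleIntegral_piecewise_const hE, hm _ hE, smul_eq_mul, ← hFsmul]
      congr 1
      ext ω
      simp [ind, SimpleFunc.piecewise_apply]
    | add _ h₁ h₂ => rw [m.simpleIntegral_add, hFadd, h₁, h₂]
  refine ⟨m, ρ, hreg, hρ, fun E hE => ?_, fun φ s => ?_⟩
  · rw [hm E hE]
    refine (hL _ (hs _)).trans (le_of_eq ?_)
    rw [← lintegral_indicator_one hE]
    congr 1
    ext ω
    by_cases hω : ω ∈ E <;> simp [ind, hω]
  · rw [hmF, ← hLe, he]
    simp only [F, ← map_sub]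
    exact hL (fun ω => φ ω - s ω) ((hmem φ).sub (hs s))

end Riesz

/-- Finitely many `ε`-balls about points of a dense sequence cover the compact range. Rounding to
the nearest point, up to the largest index used, gives a simple function. -/
theorem ContinuousMap.exists_simpleFunc_tendstoUniformly {𝕜 Ω : Type*} [RCLike 𝕜]
    [TopologicalSpace Ω] [CompactSpace Ω] [MeasurableSpace Ω] [OpensMeasurableSpace Ω]
    (φ : C(Ω, 𝕜)) :
    ∃ s : ℕ → SimpleFunc Ω 𝕜, TendstoUniformly (fun n => (s n : Ω → 𝕜)) φ atTop := by
  have key : ∀ ε : ℝ, 0 < ε → ∃ s : SimpleFunc Ω 𝕜, ∀ ω, dist (φ ω) (s ω) < ε := fun ε hε => by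
    let e := TopologicalSpace.denseSeq 𝕜
    obtain ⟨t, ht⟩ := (isCompact_range (map_continuous φ)).elim_finite_subcover
      (fun k => Metric.ball (e k) ε) (fun _ => Metric.isOpen_ball) fun z _ => by
        obtain ⟨k, hk⟩ := (TopologicalSpace.denseRange_denseSeq 𝕜).exists_dist_lt z hε
        exact Set.mem_iUnion.2 ⟨k, hk⟩
    refine ⟨(SimpleFunc.nearestPt e (t.sup id)).comp φ (map_continuous φ).measurable, fun ω => ?_⟩
    obtain ⟨k, hk, hω⟩ := Set.mem_iUnion₂.1 (ht ⟨ω, rfl⟩)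
    have h := SimpleFunc.edist_nearestPt_le e (φ ω) (Finset.le_sup (f := id) hk)
    rw [edist_dist, edist_dist, ENNReal.ofReal_le_ofReal_iff dist_nonneg] at h
    rw [Metric.mem_ball, dist_comm] at hω
    rw [dist_comm]
    exact h.trans_lt hω
  choose s hs using fun n : ℕ => key (1 / (n + 1)) Nat.one_div_pos_of_nat
  refine ⟨s, Metric.tendstoUniformly_iff.2 fun ε hε => ?_⟩
  filter_upwards [(tendsto_one_div_add_atTop_nhds_zero_nat (𝕜 := ℝ)).eventually (gt_mem_nhds hε)]
    with n hn ω using (hs n ω).trans hn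

/-! ### The universal measure with values in `C(Ω)**`. -/

section Bidual

variable {𝕜 Ω : Type*} [RCLike 𝕜] [TopologicalSpace Ω] [CompactSpace Ω] [T2Space Ω]
  [MeasurableSpace Ω] [BorelSpace Ω]

/-- The scalar measure representing a functional on `C(Ω)`. -/
noncomputable def rieszSetFunction (l : StrongDual 𝕜 C(Ω, 𝕜)) : FinAddMeasure Ω 𝕜 :=
  (exists_finAddMeasure_representing l).choose

/-- A regular measure dominating `rieszSetFunction l`. -/
noncomputable def rieszControl (l : StrongDual 𝕜 C(Ω, 𝕜)) : Measure Ω :=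
  (exists_finAddMeasure_representing l).choose_spec.choose

instance (l : StrongDual 𝕜 C(Ω, 𝕜)) : (rieszControl l).Regular :=
  (exists_finAddMeasure_representing l).choose_spec.choose_spec.1

theorem rieszControl_univ_le (l : StrongDual 𝕜 C(Ω, 𝕜)) : rieszControl l Set.univ ≤ ‖l‖ₑ :=
  (exists_finAddMeasure_representing l).choose_spec.choose_spec.2.1

instance (l : StrongDual 𝕜 C(Ω, 𝕜)) : IsFiniteMeasure (rieszControl l) :=
  ⟨(rieszControl_univ_le l).trans_lt enorm_lt_top⟩

theorem enorm_rieszSetFunction_le (l : StrongDual 𝕜 C(Ω, 𝕜)) {E : Set Ω} (hE : MeasurableSet E) :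
    ‖rieszSetFunction l E‖ₑ ≤ rieszControl l E :=
  (exists_finAddMeasure_representing l).choose_spec.choose_spec.2.2.1 E hE

theorem enorm_apply_sub_simpleIntegral_le (l : StrongDual 𝕜 C(Ω, 𝕜)) (φ : C(Ω, 𝕜))
    (s : SimpleFunc Ω 𝕜) :
    ‖l φ - (rieszSetFunction l).simpleIntegral s‖ₑ ≤ ∫⁻ ω, ‖φ ω - s ω‖ₑ ∂rieszControl l :=
  (exists_finAddMeasure_representing l).choose_spec.choose_spec.2.2.2 φ s

theorem norm_rieszSetFunction_le (l : StrongDual 𝕜 C(Ω, 𝕜)) (E : Set Ω) :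
    ‖rieszSetFunction l E‖ ≤ ‖l‖ := by
  by_cases hE : MeasurableSet E
  · rw [← enorm_le_iff_norm_le]
    exact (enorm_rieszSetFunction_le l hE).trans
      ((measure_mono (Set.subset_univ E)).trans (rieszControl_univ_le l))
  · simp [(rieszSetFunction l).not_measurable' E hE]

theorem exists_continuousMap_lintegral_sub_le {ρ : Measure Ω} [IsFiniteMeasure ρ]
    [ρ.WeaklyRegular] (s : SimpleFunc Ω 𝕜) {ε : ℝ≥0∞} (hε : ε ≠ 0) :
    ∃ φ : C(Ω, 𝕜), ∫⁻ ω, ‖φ ω - s ω‖ₑ ∂ρ ≤ ε := by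
  obtain ⟨g, hg, -⟩ :=
    (s.memLp_of_isFiniteMeasure 1 ρ).exists_boundedContinuous_eLpNorm_sub_le (by simp) hε
  refine ⟨g.toContinuousMap, ?_⟩
  rw [eLpNorm_one_eq_lintegral_enorm] at hg
  refine le_trans (le_of_eq (lintegral_congr fun ω => ?_)) hg
  exact enorm_sub_rev _ _

/-- Finitely many functionals have a common sequence of continuous functions along which they
converge to the values of their representing measures. -/
theorem exists_tendsto_rieszSetFunction {ι : Type*} [Finite ι] (l : ι → StrongDual 𝕜 C(Ω, 𝕜))
    {E : Set Ω} (hE : MeasurableSet E) :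
    ∃ φ : ℕ → C(Ω, 𝕜), ∀ i, Tendsto (fun n => l i (φ n)) atTop (𝓝 (rieszSetFunction (l i) E)) := by
  classical
  have := Fintype.ofFinite ι
  let s : SimpleFunc Ω 𝕜 :=
    SimpleFunc.piecewise E hE (SimpleFunc.const Ω 1) (SimpleFunc.const Ω 0)
  let ρ : Measure Ω := ∑ i, rieszControl (l i)
  -- Inner regularity passes to finite sums, and for a finite measure it implies weak regularity.
  have hreg : ρ.WeaklyRegular := by
    have : ρ.InnerRegular :=
      Finset.sum_induction _ Measure.InnerRegular (fun _ _ _ _ => inferInstance) inferInstance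
        fun _ _ => inferInstance
    infer_instance
  -- The tolerance is `n⁻¹` in `ℝ≥0∞`; at `n = 0` it is `∞`, which is harmless.
  choose φ hφ using fun n : ℕ => exists_continuousMap_lintegral_sub_le (ρ := ρ) s
    (ENNReal.inv_ne_zero.2 (ENNReal.natCast_ne_top n))
  refine ⟨φ, fun i => tendsto_iff_enorm_sub_tendsto_zero.2 ?_⟩
  refine tendsto_of_tendsto_of_tendsto_of_le_of_le tendsto_const_nhds
    ENNReal.tendsto_inv_nat_nhds_zero (fun _ => zero_le) fun n => ?_
  have h := enorm_apply_sub_simpleIntegral_le (l i) (φ n) s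
  rw [FinAddMeasure.simpleIntegral_piecewise_const, one_smul] at h
  refine h.trans ((lintegral_mono' ?_ le_rfl).trans (hφ n))
  exact Finset.single_le_sum (f := fun i => rieszControl (l i)) (fun _ _ => Measure.zero_le _)
    (Finset.mem_univ i)

/-- The set functions are chosen separately for each functional, so linearity is not built in; it
passes to the limit along a common approximating sequence. -/
theorem rieszSetFunction_add (l₁ l₂ : StrongDual 𝕜 C(Ω, 𝕜)) (E : Set Ω) :
    rieszSetFunction (l₁ + l₂) E = rieszSetFunction l₁ E + rieszSetFunction l₂ E := by
  by_cases hE : MeasurableSet E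
  · obtain ⟨φ, hφ⟩ := exists_tendsto_rieszSetFunction ![l₁ + l₂, l₁, l₂] hE
    exact tendsto_nhds_unique (hφ 0) ((hφ 1).add (hφ 2))
  · simp [FinAddMeasure.not_measurable' _ E hE]

theorem rieszSetFunction_smul (c : 𝕜) (l : StrongDual 𝕜 C(Ω, 𝕜)) (E : Set Ω) :
    rieszSetFunction (c • l) E = c * rieszSetFunction l E := by
  by_cases hE : MeasurableSet E
  · obtain ⟨φ, hφ⟩ := exists_tendsto_rieszSetFunction ![c • l, l] hE
    exact tendsto_nhds_unique (hφ 0) ((hφ 1).const_mul c)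
  · simp [FinAddMeasure.not_measurable' _ E hE]

variable (𝕜 Ω) in
/-- The canonical vector measure with values in `C(Ω)**`, representing the identity of `C(Ω)`. -/
noncomputable def bidualMeasure : FinAddMeasure Ω (StrongDual 𝕜 (StrongDual 𝕜 C(Ω, 𝕜))) where
  toFun E := LinearMap.mkContinuous
    { toFun := fun l => rieszSetFunction l E
      map_add' := fun l₁ l₂ => rieszSetFunction_add l₁ l₂ E
      map_smul' := fun c l => rieszSetFunction_smul c l E } 1
    fun l => by simpa using norm_rieszSetFunction_le l E
  not_measurable' E hE := by
    ext l
    exact (rieszSetFunction l).not_measurable' E hE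
  union' E F hE hF h := by
    ext l
    exact (rieszSetFunction l).union' E F hE hF h

/-- For disjoint sets and unimodular `a`, the vector `∑ a E • μ(E)` has norm at most `1`: at `l` it
is bounded by the total mass of `rieszControl l`, hence by `‖l‖`. Choosing `a` to rotate each
`w(μ(E))` to its modulus turns the variation sum into `w` of such a vector. -/
theorem bidualMeasure_semivariation_le :
    (bidualMeasure 𝕜 Ω).semivariation 𝕜 Set.univ ≤ 1 := by
  refine iSup₂_le fun w hw => FinAddMeasure.variation_le _ fun t ht _ => ?_
  choose a ha hae using fun E : Subtype (MeasurableSet (α := Ω)) =>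
    RCLike.exists_norm_eq_mul_self (w (bidualMeasure 𝕜 Ω E))
  have h1 : ‖∑ E ∈ t, a E • bidualMeasure 𝕜 Ω E‖ ≤ 1 := by
    refine ContinuousLinearMap.opNorm_le_bound _ zero_le_one fun l => ?_
    rw [one_mul, ← enorm_le_iff_norm_le]
    calc ‖(∑ E ∈ t, a E • bidualMeasure 𝕜 Ω E) l‖ₑ
        = ‖∑ E ∈ t, a E • rieszSetFunction l E‖ₑ := by
          rw [sum_apply]; rfl
      _ ≤ ∑ E ∈ t, ‖a E • rieszSetFunction l E‖ₑ := enorm_sum_le _ _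
      _ ≤ ∑ E ∈ t, rieszControl l E := by
          refine Finset.sum_le_sum fun E _ => ?_
          rw [enorm_smul, ← ofReal_norm, ha, ENNReal.ofReal_one, one_mul]
          exact enorm_rieszSetFunction_le l E.2
      _ = rieszControl l (⋃ E ∈ t, (E : Set Ω)) :=
          (measure_biUnion_finset ht fun E _ => E.2).symm
      _ ≤ rieszControl l Set.univ := measure_mono (Set.subset_univ _)
      _ ≤ ‖l‖ₑ := rieszControl_univ_le l
  calc ∑ E ∈ t, ‖((bidualMeasure 𝕜 Ω).map w) E‖ₑ
      = ENNReal.ofReal (∑ E ∈ t, ‖w (bidualMeasure 𝕜 Ω E)‖) := by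
        rw [ENNReal.ofReal_sum_of_nonneg fun _ _ => norm_nonneg _]
        simp [FinAddMeasure.map_apply]
    _ = ENNReal.ofReal ‖w (∑ E ∈ t, a E • bidualMeasure 𝕜 Ω E)‖ := by
        congr 1
        simp only [map_sum, map_smul, smul_eq_mul, ← hae]
        rw [← RCLike.ofReal_sum, RCLike.norm_ofReal,
          abs_of_nonneg (Finset.sum_nonneg fun _ _ => norm_nonneg _)]
    _ ≤ ENNReal.ofReal 1 :=
        ENNReal.ofReal_le_ofReal ((w.le_of_opNorm_le_of_le hw h1).trans (by simp))
    _ = 1 := ENNReal.ofReal_one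

/-- The error at `l` is at most the uniform distance from `φ` to the simple function times `‖l‖`, so
convergence holds in the norm of the bidual. -/
theorem bidualMeasure_hasIntegral (φ : C(Ω, 𝕜)) :
    (bidualMeasure 𝕜 Ω).HasIntegral φ (NormedSpace.inclusionInDoubleDual 𝕜 C(Ω, 𝕜) φ) := by
  refine ⟨φ.exists_simpleFunc_tendstoUniformly, fun s hs => Metric.tendsto_nhds.2 fun ε hε => ?_⟩
  filter_upwards [Metric.tendstoUniformly_iff.1 hs (ε / 2) (by positivity)] with n hn
  refine lt_of_le_of_lt ?_ (half_lt_self hε)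
  rw [dist_comm, dist_eq_norm]
  refine ContinuousLinearMap.opNorm_le_bound _ (by positivity) fun l => ?_
  have h1 : (bidualMeasure 𝕜 Ω).simpleIntegral (s n) l =
      (rieszSetFunction l).simpleIntegral (s n) :=
    ((bidualMeasure 𝕜 Ω).simpleIntegral_map (ContinuousLinearMap.apply 𝕜 𝕜 l) (s n)).symm
  rw [sub_apply, h1, NormedSpace.dual_def]
  rw [← ENNReal.ofReal_le_ofReal_iff (by positivity), ofReal_norm,
    ENNReal.ofReal_mul (by positivity), ofReal_norm]
  calc _ ≤ ∫⁻ ω, ‖φ ω - s n ω‖ₑ ∂rieszControl l := enorm_apply_sub_simpleIntegral_le l φ (s n)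
    _ ≤ ∫⁻ _, ENNReal.ofReal (ε / 2) ∂rieszControl l := by
        refine lintegral_mono fun ω => ?_
        rw [← ofReal_norm, ← dist_eq_norm]
        exact ENNReal.ofReal_le_ofReal (hn ω).le
    _ = ENNReal.ofReal (ε / 2) * rieszControl l Set.univ := lintegral_const _
    _ ≤ ENNReal.ofReal (ε / 2) * ‖l‖ₑ := by gcongr; exact rieszControl_univ_le l

end Bidual

/-! ### Transfer to operators with values in `L(X, Y)`. -/

section Operator

variable {𝕜 Ω X Y : Type*} [RCLike 𝕜] [TopologicalSpace Ω] [CompactSpace Ω]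
  [NormedAddCommGroup X] [NormedSpace 𝕜 X] [NormedAddCommGroup Y] [NormedSpace 𝕜 Y]

/-- The bilinear map `(x, y*) ↦ y* ∘ S_x` with values in `C(Ω)*`. -/
noncomputable def scalarFunctional (S : C(Ω, 𝕜) →L[𝕜] (X →L[𝕜] Y)) :
    X →L[𝕜] StrongDual 𝕜 Y →L[𝕜] StrongDual 𝕜 C(Ω, 𝕜) :=
  (ContinuousLinearMap.compL 𝕜 C(Ω, 𝕜) Y 𝕜).flip.comp S.flip

theorem scalarFunctional_apply (S : C(Ω, 𝕜) →L[𝕜] (X →L[𝕜] Y)) (x : X) (y' : StrongDual 𝕜 Y)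
    (φ : C(Ω, 𝕜)) : scalarFunctional S x y' φ = y' (S φ x) := rfl

/-- The operator `C(Ω)** → L(X, Y**)` sending `ψ` to `x ↦ y* ↦ ψ(y* ∘ S_x)`. -/
noncomputable def bidualOperator (S : C(Ω, 𝕜) →L[𝕜] (X →L[𝕜] Y)) :
    StrongDual 𝕜 (StrongDual 𝕜 C(Ω, 𝕜)) →L[𝕜] (X →L[𝕜] StrongDual 𝕜 (StrongDual 𝕜 Y)) :=
  ((ContinuousLinearMap.compL 𝕜 X (StrongDual 𝕜 Y →L[𝕜] StrongDual 𝕜 C(Ω, 𝕜))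
    (StrongDual 𝕜 (StrongDual 𝕜 Y))).flip (scalarFunctional S)).comp
    (ContinuousLinearMap.compL 𝕜 (StrongDual 𝕜 Y) (StrongDual 𝕜 C(Ω, 𝕜)) 𝕜)

theorem bidualOperator_apply (S : C(Ω, 𝕜) →L[𝕜] (X →L[𝕜] Y))
    (ψ : StrongDual 𝕜 (StrongDual 𝕜 C(Ω, 𝕜))) (x : X) (y' : StrongDual 𝕜 Y) :
    bidualOperator S ψ x y' = ψ (scalarFunctional S x y') := rfl

theorem norm_bidualOperator_le (S : C(Ω, 𝕜) →L[𝕜] (X →L[𝕜] Y)) : ‖bidualOperator S‖ ≤ ‖S‖ := by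
  refine ContinuousLinearMap.opNorm_le_bound _ (norm_nonneg _) fun ψ => ?_
  refine ContinuousLinearMap.opNorm_le_bound _ (by positivity) fun x => ?_
  refine ContinuousLinearMap.opNorm_le_bound _ (by positivity) fun y' => ?_
  rw [bidualOperator_apply]
  have h : ‖scalarFunctional S x y'‖ ≤ ‖S‖ * ‖x‖ * ‖y'‖ := by
    refine ContinuousLinearMap.opNorm_le_bound _ (by positivity) fun φ => ?_
    rw [scalarFunctional_apply]
    calc ‖y' (S φ x)‖ ≤ ‖y'‖ * (‖S‖ * ‖φ‖ * ‖x‖) :=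
          y'.le_of_opNorm_le_of_le le_rfl (S.le_opNorm₂ φ x)
      _ = _ := by ring
  calc ‖ψ (scalarFunctional S x y')‖ ≤ ‖ψ‖ * (‖S‖ * ‖x‖ * ‖y'‖) :=
        ψ.le_of_opNorm_le_of_le le_rfl h
    _ = _ := by ring

/-- The functional `A ↦ ⟨y*, A x⟩` on `L(X, Y**)`. -/
noncomputable def evalFunctional (x : X) (y' : StrongDual 𝕜 Y) :
    StrongDual 𝕜 (X →L[𝕜] StrongDual 𝕜 (StrongDual 𝕜 Y)) :=
  (ContinuousLinearMap.apply 𝕜 𝕜 y').comp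
    (ContinuousLinearMap.apply 𝕜 (StrongDual 𝕜 (StrongDual 𝕜 Y)) x)

theorem norm_evalFunctional_le (x : X) (y' : StrongDual 𝕜 Y) :
    ‖evalFunctional x y'‖ ≤ ‖x‖ * ‖y'‖ := by
  refine ContinuousLinearMap.opNorm_le_bound _ (by positivity) fun A => ?_
  calc ‖A x y'‖ ≤ ‖A‖ * ‖x‖ * ‖y'‖ := A.le_opNorm₂ x y'
    _ = _ := by ring

variable [MeasurableSpace Ω] {S : C(Ω, 𝕜) →L[𝕜] (X →L[𝕜] Y)}
  {m : FinAddMeasure Ω (X →L[𝕜] StrongDual 𝕜 (StrongDual 𝕜 Y))}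

namespace IsOperatorRepresentingMeasure

/-- Finiteness comes from the bounded semivariation of `E ↦ m(E) x` for each fixed `x`; boundedness
of `m` itself is not part of the definition. -/
theorem variation_ne_top (h : IsOperatorRepresentingMeasure S m) (x : X) (y' : StrongDual 𝕜 Y) :
    (m.map (evalFunctional x y')).variation Set.univ ≠ ∞ := by
  refine ne_top_of_le_ne_top ?_ ((m.map (ContinuousLinearMap.apply 𝕜
    (StrongDual 𝕜 (StrongDual 𝕜 Y)) x)).variation_map_le (ContinuousLinearMap.apply 𝕜 𝕜 y') _)
  exact ENNReal.mul_ne_top enorm_ne_top (h x).semivariation_lt_top.ne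

theorem hasIntegral (h : IsOperatorRepresentingMeasure S m) (x : X) (y' : StrongDual 𝕜 Y)
    (φ : C(Ω, 𝕜)) : (m.map (evalFunctional x y')).HasIntegral φ (y' (S φ x)) :=
  ((h x).integral_eq φ).map (ContinuousLinearMap.apply 𝕜 𝕜 y')

/-- Hahn–Banach computes `‖S φ x‖` from the scalars `y*(S φ x)`, which are integrals against the
scalar components of `m`. -/
theorem enorm_le_semivariation (h : IsOperatorRepresentingMeasure S m) :
    ‖S‖ₑ ≤ m.semivariation 𝕜 Set.univ := by
  rcases eq_or_ne (m.semivariation 𝕜 Set.univ) ∞ with htop | htop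
  · rw [htop]; exact le_top
  set M := (m.semivariation 𝕜 Set.univ).toReal with hM
  have hMs : m.semivariation 𝕜 Set.univ = ENNReal.ofReal M := (ENNReal.ofReal_toReal htop).symm
  have hM0 : 0 ≤ M := ENNReal.toReal_nonneg
  rw [hMs, ← ofReal_norm]
  refine ENNReal.ofReal_le_ofReal ?_
  refine ContinuousLinearMap.opNorm_le_bound _ hM0 fun φ => ?_
  refine ContinuousLinearMap.opNorm_le_bound _ (by positivity) fun x => ?_
  refine NormedSpace.norm_le_dual_bound 𝕜 _ (by positivity) fun y' => ?_
  rw [← ENNReal.ofReal_le_ofReal_iff (by positivity), ofReal_norm]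
  calc ‖y' (S φ x)‖ₑ
      ≤ ENNReal.ofReal ‖φ‖ * (m.map (evalFunctional x y')).variation Set.univ :=
        (h.hasIntegral x y' φ).enorm_le (h.variation_ne_top x y') φ.norm_coe_le_norm
    _ ≤ ENNReal.ofReal ‖φ‖ * (ENNReal.ofReal (‖x‖ * ‖y'‖) * ENNReal.ofReal M) := by
        gcongr
        refine (m.variation_map_le _ _).trans ?_
        rw [hMs, ← ofReal_norm]
        gcongr
        exact norm_evalFunctional_le x y'
    _ = ENNReal.ofReal (M * ‖φ‖ * ‖x‖ * ‖y'‖) := by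
        rw [← ENNReal.ofReal_mul (by positivity), ← ENNReal.ofReal_mul (by positivity)]
        congr 1; ring

variable [T2Space Ω] [BorelSpace Ω]

theorem unique {m' : FinAddMeasure Ω (X →L[𝕜] StrongDual 𝕜 (StrongDual 𝕜 Y))}
    (h : IsOperatorRepresentingMeasure S m) (h' : IsOperatorRepresentingMeasure S m') :
    m = m' := by
  ext E x y'
  have := FinAddMeasure.eq_of_hasIntegral_eq ((h x).regular y') ((h' x).regular y')
    (h.variation_ne_top x y') (h'.variation_ne_top x y') (h.hasIntegral x y')
    (h'.hasIntegral x y')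
  exact congrArg (fun μ : FinAddMeasure Ω 𝕜 => μ E) this

end IsOperatorRepresentingMeasure

variable [T2Space Ω] [BorelSpace Ω]

theorem isOperatorRepresentingMeasure_bidualMeasure_map (S : C(Ω, 𝕜) →L[𝕜] (X →L[𝕜] Y)) :
    IsOperatorRepresentingMeasure S ((bidualMeasure 𝕜 Ω).map (bidualOperator S)) := by
  intro x
  -- The scalar components are Riesz set functions by definition, so countable additivity and
  -- regularity follow from domination by `rieszControl`.
  have hmap : ∀ y' : StrongDual 𝕜 Y,
      (((bidualMeasure 𝕜 Ω).map (bidualOperator S)).map (ContinuousLinearMap.apply 𝕜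
        (StrongDual 𝕜 (StrongDual 𝕜 Y)) x)).map (ContinuousLinearMap.apply 𝕜 𝕜 y') =
      rieszSetFunction (scalarFunctional S x y') := fun _ => rfl
  refine ⟨?_, fun y' => ?_, fun y' => ?_, fun φ => ?_⟩
  · refine lt_of_le_of_lt ((bidualMeasure 𝕜 Ω).semivariation_map_le ((ContinuousLinearMap.apply 𝕜
      (StrongDual 𝕜 (StrongDual 𝕜 Y)) x).comp (bidualOperator S)) _) ?_
    exact ENNReal.mul_lt_top enorm_lt_top
      (bidualMeasure_semivariation_le.trans_lt ENNReal.one_lt_top)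
  · rw [hmap]
    exact FinAddMeasure.isCountablyAdditive_of_le_measure _ fun E hE =>
      enorm_rieszSetFunction_le _ hE
  · rw [hmap]
    exact FinAddMeasure.isRegular_of_le_measure _ fun E hE => enorm_rieszSetFunction_le _ hE
  -- On the canonical image of `φ`, this operator returns the canonical image of `S φ x` in `Y**`.
  · exact (bidualMeasure_hasIntegral φ).map ((ContinuousLinearMap.apply 𝕜
      (StrongDual 𝕜 (StrongDual 𝕜 Y)) x).comp (bidualOperator S))

end Operator

/-- The representing measure `m : Σ → L(X, Y**)` of `S : C(Ω) → L(X, Y)` exists and is unique, and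
its semivariation is `‖m‖(Ω) = ‖S‖`. -/
theorem proposition4p1 {𝕜 Ω X Y : Type*} [RCLike 𝕜]
    [TopologicalSpace Ω] [CompactSpace Ω] [T2Space Ω] [MeasurableSpace Ω] [BorelSpace Ω]
    [NormedAddCommGroup X] [NormedSpace 𝕜 X] [CompleteSpace X]
    [NormedAddCommGroup Y] [NormedSpace 𝕜 Y] [CompleteSpace Y]
    (S : C(Ω, 𝕜) →L[𝕜] (X →L[𝕜] Y)) :
    (∃! m : FinAddMeasure Ω (X →L[𝕜] StrongDual 𝕜 (StrongDual 𝕜 Y)),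
      IsOperatorRepresentingMeasure S m) ∧
    ∀ m : FinAddMeasure Ω (X →L[𝕜] StrongDual 𝕜 (StrongDual 𝕜 Y)),
      IsOperatorRepresentingMeasure S m → m.semivariation 𝕜 Set.univ = ‖S‖ₑ := by
  have h₀ := isOperatorRepresentingMeasure_bidualMeasure_map S
  refine ⟨⟨_, h₀, fun m hm => hm.unique h₀⟩, fun m hm => le_antisymm ?_ hm.enorm_le_semivariation⟩
  -- Uniqueness transfers the upper bound from the constructed measure to an arbitrary `m`.
  rw [hm.unique h₀]
  calc ((bidualMeasure 𝕜 Ω).map (bidualOperator S)).semivariation 𝕜 Set.univ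
      ≤ ‖bidualOperator S‖ₑ * (bidualMeasure 𝕜 Ω).semivariation 𝕜 Set.univ :=
        (bidualMeasure 𝕜 Ω).semivariation_map_le _ _
    _ ≤ ‖S‖ₑ * 1 := by
        gcongr
        · exact enorm_le_iff_norm_le.2 (norm_bidualOperator_le S)
        · exact bidualMeasure_semivariation_le
    _ = ‖S‖ₑ := mul_one _
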